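/- For integers $N\ge M\ge 1$ let $Q_{M,N}$ be the probability measure on $\mathbb{R}^M$ with density $$\frac{1}{Z_{M,N}}\prod_{i=1}^M\lambda_i^{2(N-M)}\prod_{1\le i<j\le M}|\lambda_i-\lambda_j|^2\prod_{i=1}^M e^{-N\lambda_i^2/2}$$ with respect to Lebesgue measure, where $Z_{M,N}$ is the normalizing constant. For probability measures $\mu,\nu$ on $\mathbb{R}$ let $$d_{BL}(\mu,\nu)=\sup_f\left|\int f\,d\mu-\int f\,d\nu\right|,$$ where the supremum is over all $f:\mathbb{R}\to\mathbb{R}$ with Lipschitz constant at most $1$ and $|f|\le 1$, and for a nonempty set $S$ of probability measures let $d_{BL}(\mu,S)=\inf_{\nu\in S}d_{BL}(\mu,\nu)$. Let $\mathcal{M}_0=\{p\,\delta_{\sqrt2}+(1-p)\,\delta_{-\sqrt2}:p\in[0,1]\}$. Let $(N(M))_{M\ge1}$ be integers with $N(M)\ge M$ for all $M$ and $M/N(M)\to0$ as $M\to\infty$. On a common probability space, let $(\lambda^{(M)}_1,\dots,\lambda^{(M)}_M)$, $M\ge1$, be random vectors with laws $Q_{M,N(M)}$ (their joint distribution for different $M$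 is arbitrary), and let $L_M=\frac1M\sum_{i=1}^M\delta_{\lambda^{(M)}_i}$. Then, almost surely, $d_{BL}(L_M,\mathcal{M}_0)\to0$ as $M\to\infty$. Moreover, the mean measures $\mathbb{E}[L_M]$, defined by $\mathbb{E}[L_M](A)=\mathbb{E}[L_M(A)]$ for Borel sets $A$, converge weakly (in distribution) to $\frac12\delta_{-\sqrt2}+\frac12\delta_{\sqrt2}$ as $M\to\infty$. -/

import Mathlib

open MeasureTheory ProbabilityTheory Filter Topology

namespace ConditionedGUE

noncomputable section

/-- The unnormalized density
`∏ i, x i ^ (2 (N - M)) * ∏_{i < j} |x i - x j| ^ 2 * ∏ i, exp (- N (x i) ^ 2 / 2)`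
on `ℝ ^ M`. It is only used for `M ≤ N`, where the natural subtraction is the usual one. -/
def density (M N : ℕ) (x : Fin M → ℝ) : ℝ :=
  (∏ i, x i ^ (2 * (N - M))) * (∏ i, ∏ j ∈ Finset.Ioi i, |x i - x j| ^ 2) *
    ∏ i, Real.exp (-((N : ℝ) * x i ^ 2 / 2))

/-- The normalizing constant `Z_{M,N}`. -/
def partitionFunction (M N : ℕ) : ENNReal :=
  ∫⁻ x : Fin M → ℝ, ENNReal.ofReal (density M N x)

/-- The law `Q_{M,N}` on `ℝ ^ M` of the `M` remaining eigenvalues of the conditioned GUE: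
the normalized density times Lebesgue measure. -/
def Q (M N : ℕ) : Measure (Fin M → ℝ) :=
  (partitionFunction M N)⁻¹ •
    (volume : Measure (Fin M → ℝ)).withDensity (fun x => ENNReal.ofReal (density M N x))

/-- The empirical measure `(1 / M) ∑ i, δ_{x i}`, as a measure. -/
def empiricalMeasure (M : ℕ+) (x : Fin M → ℝ) : Measure ℝ :=
  ((M : ℕ) : ENNReal)⁻¹ • ∑ i, Measure.dirac (x i)

instance instEmpirical (M : ℕ+) (x : Fin M → ℝ) :
    IsProbabilityMeasure (empiricalMeasure M x) := by
  constructor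
  have h : ((M : ℕ) : ENNReal) ≠ 0 := by exact_mod_cast M.ne_zero
  simp [empiricalMeasure, ENNReal.inv_mul_cancel h (ENNReal.natCast_ne_top _)]

/-- The empirical measure `L_M`, as a point of the space of probability measures on `ℝ`. -/
def L (M : ℕ+) (x : Fin M → ℝ) : ProbabilityMeasure ℝ :=
  ⟨empiricalMeasure M x, instEmpirical M x⟩

theorem measurable_empiricalMeasure (M : ℕ+) : Measurable (empiricalMeasure M) := by
  refine Measure.measurable_of_measurable_coe _ fun s hs => ?_
  simp only [empiricalMeasure, Measure.smul_apply, Measure.finsetSum_apply, smul_eq_mul]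
  refine Measurable.const_mul (Finset.measurable_sum _ fun i _ => ?_) _
  exact (Measure.measurable_coe hs).comp (Measure.measurable_dirac.comp (measurable_pi_apply i))

/-- The mean measure `E[L_M]`, that is `A ↦ E[L_M(A)]`, of the random empirical measure of the
random vector `X`. -/
def meanL {Ω : Type*} [MeasurableSpace Ω] (P : Measure Ω) [IsProbabilityMeasure P] (M : ℕ+)
    (X : Ω → Fin M → ℝ) (hX : AEMeasurable X P) : ProbabilityMeasure ℝ :=
  ⟨P.bind fun ω => empiricalMeasure M (X ω), by
    constructor
    have h : AEMeasurable (fun ω => empiricalMeasure M (X ω)) P :=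
      (measurable_empiricalMeasure M).comp_aemeasurable hX
    rw [Measure.bind_apply MeasurableSet.univ h]
    simp⟩

/-- The class of functions `ℝ → ℝ` with Lipschitz constant at most `1` and uniform bound `1`. -/
def FLU : Set (ℝ → ℝ) :=
  {f | LipschitzWith 1 f ∧ ∀ x, |f x| ≤ 1}

/-- The bounded Lipschitz metric. The supremum is over a nonempty set bounded by `2`. -/
def dBL (μ ν : ProbabilityMeasure ℝ) : ℝ :=
  ⨆ f : FLU, |(∫ x, f.1 x ∂(μ : Measure ℝ)) - ∫ x, f.1 x ∂(ν : Measure ℝ)|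

/-- The `d_BL`-distance from a probability measure to a (nonempty) set of probability measures. -/
def dBLSet (μ : ProbabilityMeasure ℝ) (S : Set (ProbabilityMeasure ℝ)) : ℝ :=
  ⨅ ν : S, dBL μ ν.1

/-- The measure `p δ_{√2} + (1 - p) δ_{-√2}` for `p ∈ [0,1]`. -/
def twoPoint (p : Set.Icc (0 : ℝ) 1) : ProbabilityMeasure ℝ :=
  ⟨ENNReal.ofReal p.1 • Measure.dirac (√2) + ENNReal.ofReal (1 - p.1) • Measure.dirac (-√2), by
    constructor
    simp [← ENNReal.ofReal_add p.2.1 (sub_nonneg.2 p.2.2)]⟩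

/-- The set `{p δ_{√2} + (1 - p) δ_{-√2} : p ∈ [0,1]}`. -/
def M0 : Set (ProbabilityMeasure ℝ) := Set.range twoPoint

end

end ConditionedGUE

namespace ConditionedGUE

/-! When `M / N` is small, the repulsion between particles is negligible against the one-particle
factor `x ^ (2 * N) * exp (-N * x ^ 2 / 2)`, whose maximum `(2 / e) ^ N` is attained only at `±√2`.
A large deviation bound for `∑ i, sqDev (x i)` makes this quantitative. Even after multiplying the
density by `exp (N / 4 * ∑ i, sqDev (x i))`, its integral is at most `((2 / e) ^ N * C ^ M) ^ M` up
to one-particle constants (`lintegral_tilted_density_le`). Spaced points just above `√2` give a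
lower bound for `Z` of the same leading order (`le_partitionFunction`). Markov's inequality yields a
tail summable in `M` (`exists_Q_tail_le`), and Borel–Cantelli, which needs no independence between
different `M`, gives almost sure convergence of the mean of `sqDev` to 0.

Moving each particle to `√2` or `-√2` according to its sign then bounds the distance to `M0` by the
root mean square deviation (`dBLSet_M0_le`). The concentration leaves the mass `p` undetermined. For
the mean measure, invariance of `Q` under `x ↦ -x` allows test functions to be replaced by their
even parts, which forces `p = 1 / 2`. -/

/-! ### One-particle estimates. -/

/-- The one-particle Gaussian-type weight `(x² / 2) exp (1 - x² / 2)`, maximal at `x = ±√2`. -/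
noncomputable def weight (x : ℝ) : ℝ := x ^ 2 / 2 * Real.exp (1 - x ^ 2 / 2)

theorem weight_nonneg (x : ℝ) : 0 ≤ weight x := by unfold weight; positivity

theorem integrable_weight : Integrable weight := by
  have h := integrable_rpow_mul_exp_neg_mul_sq (b := 1 / 2) (by norm_num) (s := 2) (by norm_num)
  refine (h.const_mul (Real.exp 1 / 2)).congr (.of_forall fun x => ?_)
  simp only [weight, Real.rpow_ofNat, sub_eq_add_neg, Real.exp_add]
  rw [show -(1 / 2) * x ^ 2 = -(x ^ 2 / 2) by ring]
  ring

/-- The squared distance of `|x|` to `√2`. -/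
noncomputable def sqDev (x : ℝ) : ℝ := (|x| - √2) ^ 2

theorem sqDev_nonneg (x : ℝ) : 0 ≤ sqDev x := sq_nonneg _

theorem measurable_sqDev : Measurable sqDev := by unfold sqDev; fun_prop

theorem mul_exp_one_sub_le_one (u : ℝ) : u * Real.exp (1 - u) ≤ 1 := by
  have h : u ≤ Real.exp (u - 1) := by linarith [Real.add_one_le_exp (u - 1)]
  calc u * Real.exp (1 - u) ≤ Real.exp (u - 1) * Real.exp (1 - u) := by gcongr
    _ = 1 := by rw [← Real.exp_add]; simp

theorem mul_exp_half_le_one {u : ℝ} : u * Real.exp ((1 - u ^ 2) / 2) ≤ 1 := by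
  have h : u ≤ Real.exp (u - 1) := by linarith [Real.add_one_le_exp (u - 1)]
  calc u * Real.exp ((1 - u ^ 2) / 2) ≤ Real.exp (u - 1) * Real.exp ((1 - u ^ 2) / 2) := by gcongr
    _ ≤ 1 := by
      rw [← Real.exp_add, Real.exp_le_one_iff]; nlinarith [sq_nonneg (u - 1)]

/-- The tilted one-particle weight is at most an exponential multiple of `weight`. -/
theorem tilted_weight_le {M N : ℕ} (h : 2 * M + 2 ≤ N) (x : ℝ) :
    x ^ (2 * (N - M)) * (1 + x ^ 2) ^ M * Real.exp (-((N : ℝ) * x ^ 2 / 2)) *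
      Real.exp ((N : ℝ) / 4 * sqDev x) ≤
    (2 * Real.exp (-1)) ^ N * Real.exp (1 / 2) ^ M * weight x := by
  obtain ⟨k, rfl⟩ := Nat.exists_eq_add_of_le h
  obtain ⟨u, hu, hu0⟩ : ∃ u : ℝ, |x| = √2 * u ∧ 0 ≤ u :=
    ⟨|x| / √2, by field_simp, by positivity⟩
  have h2 : (√2 : ℝ) ^ 2 = 2 := Real.sq_sqrt (by norm_num)
  have hx : x ^ 2 = 2 * u ^ 2 := by rw [← sq_abs, hu, mul_pow, h2]
  have hs : sqDev x = 2 * (u - 1) ^ 2 := by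
    rw [sqDev, hu, show √2 * u - √2 = √2 * (u - 1) by ring, mul_pow, h2]
  have hA := mul_exp_one_sub_le_one u
  have hr := mul_exp_half_le_one (u := u)
  have hB : (1 + 2 * u ^ 2) / 2 * Real.exp (1 - u ^ 2) ≤ Real.exp (1 / 2) := by
    have : (1 + 2 * u ^ 2) / 2 ≤ Real.exp (u ^ 2 - 1 / 2) := by
      linarith [Real.add_one_le_exp (u ^ 2 - 1 / 2)]
    calc _ ≤ Real.exp (u ^ 2 - 1 / 2) * Real.exp (1 - u ^ 2) := by gcongr
      _ = _ := by rw [← Real.exp_add]; ring_nf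
  -- With `|x| = √2 * u`, the tilt turns one of every two factors `u * exp ((1 - u ^ 2) / 2)` into
  -- `u * exp (1 - u)`, still at most 1. Of the spare Gaussian decay `exp ((M + 1) * (1 - u ^ 2))`,
  -- `M` copies absorb the Vandermonde factor and one makes the integrable `weight`.
  have key : x ^ (2 * (2 * M + 2 + k - M)) * (1 + x ^ 2) ^ M *
      Real.exp (-(((2 * M + 2 + k : ℕ) : ℝ) * x ^ 2 / 2)) *
      Real.exp (((2 * M + 2 + k : ℕ) : ℝ) / 4 * sqDev x) =
      (2 * Real.exp (-1)) ^ (2 * M + 2 + k) *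
      ((u * Real.exp (1 - u)) ^ (2 * M + 2 + k) * (u * Real.exp ((1 - u ^ 2) / 2)) ^ k *
      ((1 + 2 * u ^ 2) / 2 * Real.exp (1 - u ^ 2)) ^ M) * weight x := by
    rw [weight, hs, pow_mul, hx, show 2 * M + 2 + k - M = M + 2 + k by omega]
    simp only [mul_pow, ← Real.exp_nat_mul]
    have : Real.exp (-(((2 * M + 2 + k : ℕ) : ℝ) * (2 * u ^ 2) / 2)) *
      Real.exp (((2 * M + 2 + k : ℕ) : ℝ) / 4 * (2 * (u - 1) ^ 2)) =
      Real.exp (((2 * M + 2 + k : ℕ) : ℝ) * -1) * Real.exp (((2 * M + 2 + k : ℕ) : ℝ) * (1 - u)) *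
      Real.exp (k * ((1 - u ^ 2) / 2)) * Real.exp (M * (1 - u ^ 2)) *
      Real.exp (1 - 2 * u ^ 2 / 2) := by
      simp only [← Real.exp_add]
      congr 1
      push_cast
      ring
    rw [mul_assoc, this, div_pow]
    field_simp
    ring
  rw [key]
  refine mul_le_mul_of_nonneg_right (mul_le_mul_of_nonneg_left ?_ (by positivity)) (weight_nonneg x)
  calc _ ≤ 1 * 1 * Real.exp (1 / 2) ^ M := by
        gcongr
        · exact pow_le_one₀ (by positivity) hA
        · exact pow_le_one₀ (by positivity) hr
    _ = _ := by simp

/-! ### Upper bound for the tilted density. -/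

theorem sq_abs_sub_le (a b : ℝ) : |a - b| ^ 2 ≤ (1 + a ^ 2) * (1 + b ^ 2) := by
  rw [sq_abs]; nlinarith [sq_nonneg (a * b + 1)]

/-- Decouples the particles, so that the tilted integral factorizes. Each `x j` occurs in `M - 1`
pairs; since `1 + x j ^ 2 ≥ 1`, adding the diagonal only increases the product. -/
theorem vandermonde_sq_le {M : ℕ} (x : Fin M → ℝ) :
    ∏ i, ∏ j ∈ Finset.Ioi i, |x i - x j| ^ 2 ≤ ∏ i, (1 + x i ^ 2) ^ M := by
  calc _ ≤ ∏ i, ∏ j ∈ Finset.Ioi i, (1 + x j ^ 2) * (1 + x i ^ 2) := by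
        refine Finset.prod_le_prod (fun i _ => Finset.prod_nonneg fun j _ => by positivity)
          fun i _ => Finset.prod_le_prod (fun j _ => by positivity) fun j _ => ?_
        rw [mul_comm]
        exact sq_abs_sub_le _ _
    _ = ∏ i, ∏ j ∈ {i}ᶜ, (1 + x j ^ 2) :=
        Finset.prod_prod_Ioi_mul_eq_prod_prod_off_diag fun j _ => 1 + x j ^ 2
    _ ≤ ∏ i : Fin M, ∏ j, (1 + x j ^ 2) := by
        refine Finset.prod_le_prod (fun i _ => Finset.prod_nonneg fun j _ => by positivity)
          fun i _ => ?_
        refine Finset.prod_le_prod_of_subset_of_one_le (Finset.subset_univ _)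
          (fun j _ => by positivity) fun j _ _ => by nlinarith [sq_nonneg (x j)]
    _ = _ := by simp [Finset.prod_pow]

theorem density_nonneg (M N : ℕ) (x : Fin M → ℝ) : 0 ≤ density M N x := by
  unfold density
  refine mul_nonneg (mul_nonneg (Finset.prod_nonneg fun i _ => ?_)
    (Finset.prod_nonneg fun i _ => Finset.prod_nonneg fun j _ => by positivity))
    (Finset.prod_nonneg fun i _ => by positivity)
  rw [pow_mul]; positivity

theorem measurable_density (M N : ℕ) : Measurable (density M N) := by
  unfold density; fun_prop

theorem density_neg (M N : ℕ) (x : Fin M → ℝ) : density M N (-x) = density M N x := by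
  have h (i j : Fin M) : |(-x) i - (-x) j| = |x i - x j| := by
    rw [Pi.neg_apply, Pi.neg_apply, ← abs_neg]; ring_nf
  simp only [density, h]
  simp [pow_mul]

/-- The tilted density is dominated by a product density. -/
theorem tilted_density_le {M N : ℕ} (h : 2 * M + 2 ≤ N) (x : Fin M → ℝ) :
    density M N x * Real.exp ((N : ℝ) / 4 * ∑ i, sqDev (x i)) ≤
      ∏ i, ((2 * Real.exp (-1)) ^ N * Real.exp (1 / 2) ^ M * weight (x i)) := by
  calc _ ≤ (∏ i, x i ^ (2 * (N - M))) * (∏ i, (1 + x i ^ 2) ^ M) *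
        (∏ i, Real.exp (-((N : ℝ) * x i ^ 2 / 2))) * ∏ i, Real.exp ((N : ℝ) / 4 * sqDev (x i)) := by
        rw [density, Finset.mul_sum, Real.exp_sum]
        have : 0 ≤ ∏ i, x i ^ (2 * (N - M)) :=
          Finset.prod_nonneg fun i _ => by rw [pow_mul]; positivity
        have hv := mul_le_mul_of_nonneg_left (vandermonde_sq_le x) this
        exact mul_le_mul_of_nonneg_right (mul_le_mul_of_nonneg_right hv
          (Finset.prod_nonneg fun i _ => by positivity)) (Finset.prod_nonneg fun i _ => by positivity)
    _ ≤ _ := by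
        simp only [← Finset.prod_mul_distrib]
        refine Finset.prod_le_prod (fun i _ => ?_) fun i _ => tilted_weight_le h (x i)
        rw [pow_mul]; positivity

theorem lintegral_tilted_density_le {M N : ℕ} (h : 2 * M + 2 ≤ N) :
    ∫⁻ x : Fin M → ℝ, ENNReal.ofReal (density M N x * Real.exp ((N : ℝ) / 4 * ∑ i, sqDev (x i))) ≤
      ENNReal.ofReal (((2 * Real.exp (-1)) ^ N * Real.exp (1 / 2) ^ M * ∫ x, weight x) ^ M) := by
  refine (lintegral_mono fun x => ENNReal.ofReal_le_ofReal (tilted_density_le h x)).trans_eq ?_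
  rw [← ofReal_integral_eq_lintegral_ofReal]
  · rw [integral_fintype_prod_volume_eq_pow fun x : ℝ =>
      (2 * Real.exp (-1)) ^ N * Real.exp (1 / 2) ^ M * weight x, integral_const_mul,
      Fintype.card_fin]
  · exact Integrable.fintype_prod (μ := fun _ => volume) fun _ => integrable_weight.const_mul _
  · exact .of_forall fun x => Finset.prod_nonneg fun i _ =>
      mul_nonneg (by positivity) (weight_nonneg _)

/-! ### Lower bound for the partition function. -/

/-- The product is `n ! / M ^ n` with `n = M - 1 - i`, and `M ^ n / n !` is a single term of the
series of `exp M`. -/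
theorem exp_neg_le_prod_Ioi_div {M : ℕ} (i : Fin M) :
    Real.exp (-M) ≤ ∏ j ∈ Finset.Ioi i, (((j : ℕ) : ℝ) - (i : ℕ)) / M := by
  have hM : (0 : ℝ) < M := by exact_mod_cast i.pos
  have h1 : ∏ j ∈ Finset.Ioi i, (((j : ℕ) : ℝ) - (i : ℕ)) / M =
      ∏ k ∈ Finset.range (M - 1 - i), ((k + 1 : ℕ) : ℝ) / M := by
    refine Finset.prod_bij (fun j _ => (j : ℕ) - i - 1) ?_ ?_ ?_ ?_
    · intro j hj
      have : i < j := by simpa using hj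
      simp only [Finset.mem_range]; omega
    · intro a ha b hb hab
      have h1 : i < a := by simpa using ha
      have h2 : i < b := by simpa using hb
      ext; omega
    · intro k hk
      have : k < M - 1 - i := by simpa using hk
      refine ⟨⟨k + 1 + i, by omega⟩, ?_, ?_⟩
      · simp only [Finset.mem_Ioi, Fin.lt_def]; omega
      · simp only; omega
    · intro j hj
      have : (i : ℕ) < j := by simpa using hj
      rw [← Nat.cast_sub this.le]
      congr 2
      omega
  rw [h1, Finset.prod_div_distrib, Finset.prod_const, Finset.card_range, ← Nat.cast_prod,
    Finset.prod_range_add_one_eq_factorial, Real.exp_neg, ← one_div_div, ← one_div]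
  exact one_div_le_one_div_of_le (by positivity) (Real.pow_div_factorial_le_exp _ (by positivity) _)

/-- Lower bound for the density on a box of well separated points slightly above `√2`. -/
theorem le_density_of_mem_box {M N : ℕ} (hMN : M ≤ N) {δ : ℝ} (hδ : 0 < δ) (hδ1 : δ ≤ 1)
    {x : Fin M → ℝ} (hx : ∀ i : Fin M,
      x i ∈ Set.Icc (√2 + δ / M * (i : ℕ)) (√2 + δ / M * ((i : ℕ) + 1 / 2))) :
    ((2 * Real.exp (-1)) ^ N * Real.exp (-(2 * δ * N)) * ((1 / 2) * (δ / 2) ^ 2 * Real.exp (-2)) ^ M)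
      ^ M ≤ density M N x := by
  have h2 : (√2 : ℝ) ^ 2 = 2 := Real.sq_sqrt (by norm_num)
  have h2' : (√2 : ℝ) ≤ 3 / 2 := by
    rw [Real.sqrt_le_left (by norm_num)]; norm_num
  have hlo (i : Fin M) : √2 ≤ x i := by
    refine le_trans ?_ (hx i).1
    have : 0 ≤ δ / M * (i : ℕ) := by positivity
    linarith
  have hhi (i : Fin M) : x i ≤ √2 + δ := by
    have hM : (0 : ℝ) < M := by exact_mod_cast i.pos
    have hi : ((i : ℕ) : ℝ) + 1 ≤ M := by exact_mod_cast i.2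
    refine (hx i).2.trans ?_
    have : δ / M * ((i : ℕ) + 1 / 2) ≤ δ / M * M := by gcongr; linarith
    rw [div_mul_cancel₀ _ hM.ne'] at this
    linarith
  have hpow (i : Fin M) : (2 : ℝ) ^ (N - M) ≤ x i ^ (2 * (N - M)) := by
    rw [pow_mul]
    gcongr
    rw [← h2]
    have := hlo i
    gcongr
  have hexp (i : Fin M) : Real.exp (-1) ^ N * Real.exp (-(2 * δ * N)) ≤
      Real.exp (-((N : ℝ) * x i ^ 2 / 2)) := by
    rw [← Real.exp_nat_mul, ← Real.exp_add, Real.exp_le_exp]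
    have h3 : x i ^ 2 ≤ (√2 + δ) ^ 2 := by
      have := hhi i
      have := hlo i
      have : 0 ≤ x i := (Real.sqrt_nonneg 2).trans this
      gcongr
    have h4 : x i ^ 2 / 2 ≤ 1 + 2 * δ := by nlinarith
    have : (N : ℝ) * (x i ^ 2 / 2) ≤ N * (1 + 2 * δ) := by gcongr
    linarith
  have hdiff (i j : Fin M) (hij : i < j) :
      (δ / 2) ^ 2 * ((((j : ℕ) : ℝ) - (i : ℕ)) / M) ^ 2 ≤ |x i - x j| ^ 2 := by
    have hM : (0 : ℝ) < M := by exact_mod_cast i.pos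
    have h1 : ((i : ℕ) : ℝ) + 1 ≤ (j : ℕ) := by exact_mod_cast hij
    rw [← mul_pow, abs_sub_comm]
    have h5 : δ / 2 * ((((j : ℕ) : ℝ) - (i : ℕ)) / M) ≤ x j - x i := by
      have ha := (hx j).1
      have hb := (hx i).2
      -- Each interval fills half of its cell of width `δ / M`, and `j - i - 1 / 2 ≥ (j - i) / 2`
      -- because `j - i ≥ 1`.
      have : δ / M * ((((j : ℕ) : ℝ) - (i : ℕ)) / 2) ≤ δ / M * ((j : ℕ) - ((i : ℕ) + 1 / 2)) := by
        gcongr; linarith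
      calc _ = δ / M * ((((j : ℕ) : ℝ) - (i : ℕ)) / 2) := by ring
        _ ≤ _ := by linarith
    have h6 : 0 ≤ δ / 2 * ((((j : ℕ) : ℝ) - (i : ℕ)) / M) := by
      have : 0 ≤ ((j : ℕ) : ℝ) - (i : ℕ) := by linarith
      positivity
    exact pow_le_pow_left₀ h6 (h5.trans (le_abs_self _)) 2
  have hvan (i : Fin M) : ((δ / 2) ^ 2 * Real.exp (-2)) ^ M ≤
      ∏ j ∈ Finset.Ioi i, |x i - x j| ^ 2 := by
    calc _ = ((δ / 2) ^ 2) ^ M * Real.exp (-M) ^ 2 := by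
          rw [mul_pow, ← Real.exp_nat_mul, ← Real.exp_nat_mul]; congr 2; push_cast; ring
      _ ≤ ((δ / 2) ^ 2) ^ (Finset.Ioi i).card *
          (∏ j ∈ Finset.Ioi i, (((j : ℕ) : ℝ) - (i : ℕ)) / M) ^ 2 := by
          refine mul_le_mul ?_ ?_ (by positivity) (by positivity)
          · refine pow_le_pow_of_le_one (by positivity) (pow_le_one₀ (by positivity) (by linarith)) ?_
            exact (Finset.card_le_univ _).trans_eq (Fintype.card_fin M)
          · exact pow_le_pow_left₀ (by positivity) (exp_neg_le_prod_Ioi_div i) 2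
      _ = ∏ j ∈ Finset.Ioi i, (δ / 2) ^ 2 * ((((j : ℕ) : ℝ) - (i : ℕ)) / M) ^ 2 := by
          rw [Finset.prod_mul_distrib, Finset.prod_const, Finset.prod_pow]
      _ ≤ _ := Finset.prod_le_prod (fun j _ => by positivity) fun j hj =>
          hdiff i j (Finset.mem_Ioi.1 hj)
  have hcard (c : ℝ) : c ^ M = ∏ _i : Fin M, c := by simp
  rw [hcard, density, ← Finset.prod_mul_distrib, ← Finset.prod_mul_distrib]
  refine Finset.prod_le_prod (fun i _ => by positivity) fun i _ => ?_
  calc _ = 2 ^ (N - M) * ((δ / 2) ^ 2 * Real.exp (-2)) ^ M *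
        (Real.exp (-1) ^ N * Real.exp (-(2 * δ * N))) := by
        obtain ⟨k, rfl⟩ := Nat.exists_eq_add_of_le hMN
        rw [Nat.add_sub_cancel_left, mul_pow, mul_pow, mul_pow, mul_pow, pow_add 2 M k, div_pow,
          one_pow]
        field_simp
    _ ≤ _ := by
        have h1 := hpow i
        have h2 := hvan i
        have h3 := hexp i
        have : (0 : ℝ) ≤ x i ^ (2 * (N - M)) := le_trans (by positivity) h1
        gcongr

/-- Lower bound for the normalizing constant. -/
theorem le_partitionFunction {M N : ℕ} (hM0 : 0 < M) (hMN : M ≤ N) {δ : ℝ} (hδ : 0 < δ)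
    (hδ1 : δ ≤ 1) :
    ENNReal.ofReal (((2 * Real.exp (-1)) ^ N * Real.exp (-(2 * δ * N)) *
      ((1 / 2) * (δ / 2) ^ 3 * Real.exp (-3)) ^ M) ^ M) ≤ partitionFunction M N := by
  have hM : (0 : ℝ) < M := by exact_mod_cast hM0
  set a : Fin M → ℝ := fun i => √2 + δ / M * (i : ℕ)
  set b : Fin M → ℝ := fun i => √2 + δ / M * ((i : ℕ) + 1 / 2)
  set c := ((2 * Real.exp (-1)) ^ N * Real.exp (-(2 * δ * N)) *
    ((1 / 2) * (δ / 2) ^ 2 * Real.exp (-2)) ^ M) ^ M with hc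
  have hvol : volume (Set.Icc a b) = ENNReal.ofReal ((δ / 2 / M) ^ M) := by
    have : ∀ i, b i - a i = δ / 2 / M := fun i => by simp only [a, b]; ring
    rw [Real.volume_Icc_pi]
    simp only [this, Finset.prod_const, Finset.card_univ, Fintype.card_fin]
    rw [ENNReal.ofReal_pow (by positivity)]
  -- The box side is absorbed into the `M`-th power; this raises the exponents 2 and -2 of the
  -- density bound to 3 and -3.
  have hside : ((δ / 2) * Real.exp (-1)) ^ M ≤ δ / 2 / M := by
    have h1 : (δ / 2) ^ M ≤ δ / 2 := pow_le_of_le_one (by positivity) (by linarith) hM0.ne'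
    have h2 : Real.exp (-1) ^ M ≤ 1 / M := by
      rw [← Real.exp_nat_mul, mul_neg_one, Real.exp_neg, ← one_div]
      exact one_div_le_one_div_of_le hM (by linarith [Real.add_one_le_exp (M : ℝ)])
    calc _ = (δ / 2) ^ M * Real.exp (-1) ^ M := mul_pow _ _ _
      _ ≤ δ / 2 * (1 / M) := by gcongr
      _ = _ := by ring
  calc _ ≤ ENNReal.ofReal (c * (δ / 2 / M) ^ M) := by
        refine ENNReal.ofReal_le_ofReal ?_
        rw [hc, ← mul_pow]
        refine pow_le_pow_left₀ (by positivity) ?_ M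
        have he : Real.exp (-3) = Real.exp (-2) * Real.exp (-1) := by
          rw [← Real.exp_add]; norm_num
        calc _ = (2 * Real.exp (-1)) ^ N * Real.exp (-(2 * δ * N)) *
              ((1 / 2) * (δ / 2) ^ 2 * Real.exp (-2)) ^ M * ((δ / 2) * Real.exp (-1)) ^ M := by
              rw [mul_assoc _ (_ ^ M) (_ ^ M), ← mul_pow, he]; ring
          _ ≤ _ := by gcongr
    _ = ENNReal.ofReal c * volume (Set.Icc a b) := by
        rw [hvol, ENNReal.ofReal_mul (by positivity)]
    _ = ∫⁻ _ in Set.Icc a b, ENNReal.ofReal c := by rw [setLIntegral_const]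
    _ ≤ ∫⁻ x in Set.Icc a b, ENNReal.ofReal (density M N x) :=
        setLIntegral_mono' measurableSet_Icc fun x hx => ENNReal.ofReal_le_ofReal
          (le_density_of_mem_box hMN hδ hδ1 fun i => ⟨hx.1 i, hx.2 i⟩)
    _ ≤ _ := setLIntegral_le_lintegral _ _

/-! ### Concentration and Borel–Cantelli. -/

/-- Markov's inequality for the tilted density. -/
theorem setLIntegral_density_le {M N : ℕ} (h : 2 * M + 2 ≤ N) (ε : ℝ) :
    ∫⁻ x in {x : Fin M → ℝ | ε * M ≤ ∑ i, sqDev (x i)}, ENNReal.ofReal (density M N x) ≤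
      ENNReal.ofReal ((Real.exp (-((N : ℝ) / 4 * ε)) *
        ((2 * Real.exp (-1)) ^ N * Real.exp (1 / 2) ^ M * ∫ x, weight x)) ^ M) := by
  have hm : MeasurableSet {x : Fin M → ℝ | ε * M ≤ ∑ i, sqDev (x i)} :=
    measurableSet_le measurable_const
      (Finset.measurable_fun_sum _ fun i _ => measurable_sqDev.comp (measurable_pi_apply i))
  calc _ ≤ ∫⁻ x in {x : Fin M → ℝ | ε * M ≤ ∑ i, sqDev (x i)},
        ENNReal.ofReal (Real.exp (-((N : ℝ) / 4 * ε)) ^ M) *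
        ENNReal.ofReal (density M N x * Real.exp ((N : ℝ) / 4 * ∑ i, sqDev (x i))) := by
        refine setLIntegral_mono' hm fun x hx => ?_
        rw [← ENNReal.ofReal_mul (by positivity)]
        refine ENNReal.ofReal_le_ofReal ?_
        rw [mul_left_comm, ← Real.exp_nat_mul, ← Real.exp_add]
        refine le_mul_of_one_le_right (density_nonneg _ _ _) (Real.one_le_exp ?_)
        have : (N : ℝ) / 4 * (ε * M) ≤ N / 4 * ∑ i, sqDev (x i) :=
          mul_le_mul_of_nonneg_left hx (by positivity)
        linarith
    _ ≤ ∫⁻ x : Fin M → ℝ, ENNReal.ofReal (Real.exp (-((N : ℝ) / 4 * ε)) ^ M) *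
        ENNReal.ofReal (density M N x * Real.exp ((N : ℝ) / 4 * ∑ i, sqDev (x i))) :=
        setLIntegral_le_lintegral _ _
    _ ≤ _ := by
        rw [lintegral_const_mul' _ _ ENNReal.ofReal_ne_top, mul_pow, ENNReal.ofReal_mul (by positivity)]
        gcongr
        exact lintegral_tilted_density_le h

/-- Exponential concentration of the particles near `±√2` when `M / N` is small. -/
theorem exists_Q_tail_le {ε : ℝ} (hε : 0 < ε) (hε1 : ε ≤ 1) :
    ∃ κ : ℝ, 0 < κ ∧ ∀ M N : ℕ, 0 < M → (M : ℝ) ≤ κ * N →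
      Q M N {x | ε * M ≤ ∑ i, sqDev (x i)} ≤ ENNReal.ofReal (Real.exp (-(ε / 8)) ^ M) := by
  obtain ⟨δ, hδ⟩ : ∃ δ, δ = ε / 32 := ⟨_, rfl⟩
  have hδ0 : 0 < δ := by rw [hδ]; positivity
  obtain ⟨c, hc⟩ : ∃ c, c = (1 / 2) * (δ / 2) ^ 3 * Real.exp (-3) := ⟨_, rfl⟩
  have hc0 : 0 < c := by rw [hc]; positivity
  -- The maximum with 1 ensures `I ≤ I ^ M`, so the integral of `weight` fits into the factor `D ^
  -- M`.
  obtain ⟨I, hI⟩ : ∃ I, I = max (∫ x, weight x) 1 := ⟨_, rfl⟩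
  have hI1 : 1 ≤ I := hI ▸ le_max_right _ _
  obtain ⟨D, hD⟩ : ∃ D, D = Real.exp (1 / 2) * I / c := ⟨_, rfl⟩
  have hI0 : 0 < I := by linarith
  have hD0 : 0 < D := by rw [hD]; positivity
  -- The first bound gives `2 * M + 2 ≤ 4 * M ≤ N`; the second gives `D * M ≤ ε * N / 16`, which
  -- controls `D ^ M ≤ exp (D * M)`.
  refine ⟨min (1 / 4) (ε / (16 * D)), by positivity, fun M N hM0 hMN => ?_⟩
  have hM1 : (1 : ℝ) ≤ M := by exact_mod_cast hM0
  have h4 : (M : ℝ) ≤ 1 / 4 * N := hMN.trans (by gcongr; exact min_le_left _ _)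
  have hDM : D * M ≤ ε / 16 * N := by
    have : (M : ℝ) ≤ ε / (16 * D) * N := hMN.trans (by gcongr; exact min_le_right _ _)
    calc D * M ≤ D * (ε / (16 * D) * N) := by gcongr
      _ = _ := by field_simp
  have h4' : 4 * M ≤ N := by
    have : (4 * M : ℝ) ≤ N := by linarith
    exact_mod_cast this
  have hZ := le_partitionFunction hM0 (by omega : M ≤ N) hδ0 (by linarith)
  rw [← hc] at hZ
  set a := (2 * Real.exp (-1)) ^ N * Real.exp (-(2 * δ * N)) * c ^ M with ha
  have ha0 : 0 < a := by positivity
  have hm : MeasurableSet {x : Fin M → ℝ | ε * M ≤ ∑ i, sqDev (x i)} :=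
    measurableSet_le measurable_const
      (Finset.measurable_fun_sum _ fun i _ => measurable_sqDev.comp (measurable_pi_apply i))
  rw [Q, Measure.smul_apply, withDensity_apply _ hm, smul_eq_mul]
  calc _ ≤ (ENNReal.ofReal (a ^ M))⁻¹ * ENNReal.ofReal ((Real.exp (-((N : ℝ) / 4 * ε)) *
        ((2 * Real.exp (-1)) ^ N * Real.exp (1 / 2) ^ M * ∫ x, weight x)) ^ M) := by
        gcongr
        exact setLIntegral_density_le (by omega) ε
    _ = ENNReal.ofReal ((a⁻¹ * (Real.exp (-((N : ℝ) / 4 * ε)) *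
        ((2 * Real.exp (-1)) ^ N * Real.exp (1 / 2) ^ M * ∫ x, weight x))) ^ M) := by
        rw [← ENNReal.ofReal_inv_of_pos (by positivity), ← ENNReal.ofReal_mul (by positivity),
          ← inv_pow, ← mul_pow]
    _ ≤ _ := by
        have hw : 0 ≤ ∫ x, weight x := integral_nonneg weight_nonneg
        refine ENNReal.ofReal_le_ofReal (pow_le_pow_left₀ (by positivity) ?_ M)
        have hwI : ∫ x, weight x ≤ I ^ M :=
          (hI ▸ le_max_left _ _ : ∫ x, weight x ≤ I).trans (le_self_pow₀ hI1 hM0.ne')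
        calc _ ≤ a⁻¹ * (Real.exp (-((N : ℝ) / 4 * ε)) *
              ((2 * Real.exp (-1)) ^ N * Real.exp (1 / 2) ^ M * I ^ M)) := by gcongr
          _ = Real.exp (-((N : ℝ) / 4 * ε)) * Real.exp (2 * δ * N) * D ^ M := by
              rw [ha, hD, div_pow, mul_pow _ I, Real.exp_neg (2 * δ * N)]
              field_simp
          _ ≤ Real.exp (-((N : ℝ) / 4 * ε)) * Real.exp (2 * δ * N) * Real.exp D ^ M := by
              gcongr
              linarith [Real.add_one_le_exp D]
          _ ≤ _ := by
              -- In units of `ε * N`, the exponent is at most `-1/4 + 1/16 + 1/16 = -1/8`: tilt, box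
              -- width `δ = ε / 32`, and `D ^ M`. Then `N ≥ 1`.
              rw [← Real.exp_nat_mul, ← Real.exp_add, ← Real.exp_add, Real.exp_le_exp, hδ]
              have : ε * 1 ≤ ε * N := by gcongr; linarith
              linarith

/-- Almost surely, the mean squared distance of the particles to `{-√2, √2}` vanishes. -/
theorem ae_tendsto_mean_sqDev {Ω : Type*} [MeasurableSpace Ω] {P : Measure Ω}
    {N : ℕ+ → ℕ} (hMN : ∀ M : ℕ+, (M : ℕ) ≤ N M)
    (hN : Tendsto (fun M : ℕ+ => ((M : ℕ) : ℝ) / (N M : ℝ)) atTop (𝓝 0))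
    {X : (M : ℕ+) → Ω → Fin M → ℝ} (hX : ∀ M : ℕ+, HasLaw (X M) (Q M (N M)) P) :
    ∀ᵐ ω ∂P, Tendsto (fun M : ℕ+ => (∑ i, sqDev (X M ω i)) / (M : ℕ)) atTop (𝓝 0) := by
  have key (ε : ℝ) (hε : 0 < ε) (hε1 : ε ≤ 1) :
      ∀ᵐ ω ∂P, ∀ᶠ M : ℕ+ in atTop, (∑ i, sqDev (X M ω i)) / (M : ℕ) < ε := by
    obtain ⟨κ, hκ, hQ⟩ := exists_Q_tail_le hε hε1
    obtain ⟨M₀, hM₀⟩ := eventually_atTop.1 (hN.eventually (gt_mem_nhds hκ))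
    -- Including `M₀ ≤ M` in the event makes it empty for the finitely many small `M`, so the bound
    -- holds for every `M`.
    have hbound (M : ℕ+) : P {ω | M₀ ≤ M ∧ ε * (M : ℕ) ≤ ∑ i, sqDev (X M ω i)} ≤
        ENNReal.ofReal (Real.exp (-(ε / 8)) ^ (M : ℕ)) := by
      by_cases h : M₀ ≤ M
      · have hm : MeasurableSet {x : Fin M → ℝ | ε * (M : ℕ) ≤ ∑ i, sqDev (x i)} :=
          measurableSet_le measurable_const
            (Finset.measurable_fun_sum _ fun i _ => measurable_sqDev.comp (measurable_pi_apply i))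
        have hNpos : (0 : ℝ) < N M := by exact_mod_cast M.pos.trans_le (hMN M)
        have := hQ M (N M) M.pos ((div_le_iff₀ hNpos).1 (hM₀ M h).le)
        rw [← (hX M).map_eq, Measure.map_apply_of_aemeasurable (hX M).aemeasurable hm] at this
        simpa [h] using this
      · simp [h]
    have hsum : Summable fun M : ℕ+ => Real.exp (-(ε / 8)) ^ (M : ℕ) :=
      (summable_geometric_of_lt_one (Real.exp_pos _).le
        (Real.exp_lt_one_iff.2 (by linarith))).comp_injective PNat.coe_injective
    have hne := ((ENNReal.tsum_le_tsum hbound).trans_lt hsum.tsum_ofReal_lt_top).ne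
    filter_upwards [ae_finite_setOfPred_mem hne] with ω hω
    obtain ⟨B, hB⟩ := hω.bddAbove
    filter_upwards [eventually_gt_atTop B, eventually_ge_atTop M₀] with M h1 h2
    have hMpos : (0 : ℝ) < (M : ℕ) := by exact_mod_cast M.pos
    rw [div_lt_iff₀ hMpos]
    by_contra hcon
    exact absurd (hB (show M ∈ _ from ⟨h2, not_lt.1 hcon⟩)) (not_le.2 h1)
  have hall : ∀ᵐ ω ∂P, ∀ k : ℕ, ∀ᶠ M : ℕ+ in atTop,
      (∑ i, sqDev (X M ω i)) / (M : ℕ) < 1 / ((k : ℝ) + 1) :=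
    ae_all_iff.2 fun k => key _ (by positivity)
      ((div_le_one (by positivity)).2 (by linarith [(Nat.cast_nonneg k : (0 : ℝ) ≤ k)]))
  filter_upwards [hall] with ω hω
  refine tendsto_order.2 ⟨fun a ha => .of_forall fun M => ha.trans_le
    (div_nonneg (Finset.sum_nonneg fun i _ => sqDev_nonneg _) (by positivity)), fun a ha => ?_⟩
  obtain ⟨k, hk⟩ := exists_nat_one_div_lt ha
  exact (hω k).mono fun M hM => hM.trans hk

/-! ### Distance from the empirical measure to the two-point measures. -/

theorem integral_empiricalMeasure (M : ℕ+) (x : Fin M → ℝ) (f : ℝ → ℝ) :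
    ∫ y, f y ∂(empiricalMeasure M x) = (∑ i, f (x i)) / (M : ℕ) := by
  rw [empiricalMeasure, integral_smul_measure, integral_finsetSum_measure]
  · simp [div_eq_inv_mul]
  · exact fun i _ => integrable_dirac enorm_lt_top

theorem integral_twoPoint (p : Set.Icc (0 : ℝ) 1) (f : ℝ → ℝ) :
    ∫ y, f y ∂(twoPoint p : Measure ℝ) = p.1 * f √2 + (1 - p.1) * f (-√2) := by
  change ∫ y, f y ∂(ENNReal.ofReal p.1 • Measure.dirac (√2) +
    ENNReal.ofReal (1 - p.1) • Measure.dirac (-√2)) = _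
  rw [integral_add_measure, integral_smul_measure, integral_smul_measure]
  · simp [ENNReal.toReal_ofReal p.2.1, ENNReal.toReal_ofReal (sub_nonneg.2 p.2.2)]
  · exact (integrable_dirac enorm_lt_top).smul_measure ENNReal.ofReal_ne_top
  · exact (integrable_dirac enorm_lt_top).smul_measure ENNReal.ofReal_ne_top

/-- Cauchy–Schwarz for the mean distance to `{-√2, √2}`. -/
theorem mean_dev_le_sqrt (M : ℕ+) (x : Fin M → ℝ) :
    (∑ i, |(|x i| - √2)|) / (M : ℕ) ≤ √((∑ i, sqDev (x i)) / (M : ℕ)) := by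
  have hM : (0 : ℝ) < (M : ℕ) := by exact_mod_cast M.pos
  refine Real.le_sqrt_of_sq_le ?_
  have h := sq_sum_le_card_mul_sum_sq (s := Finset.univ) (f := fun i => |(|x i| - √2)|)
  simp only [sq_abs, Finset.card_univ, Fintype.card_fin] at h
  rw [div_pow, div_le_div_iff₀ (by positivity) hM]
  simp only [sqDev]
  nlinarith

/-- If `f` varies from `g` by at most `K` times the distance to `{-√2, √2}`, so do their means,
up to passing to the root mean square. -/
theorem abs_mean_sub_mean_le (M : ℕ+) (x : Fin M → ℝ) {f g : ℝ → ℝ} {K : ℝ} (hK : 0 ≤ K)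
    (h : ∀ y, |f y - g y| ≤ K * |(|y| - √2)|) :
    |(∑ i, f (x i)) / (M : ℕ) - (∑ i, g (x i)) / (M : ℕ)| ≤
      K * √((∑ i, sqDev (x i)) / (M : ℕ)) := by
  rw [← sub_div, ← Finset.sum_sub_distrib, abs_div, Nat.abs_cast]
  calc _ ≤ (∑ i, K * |(|x i| - √2)|) / (M : ℕ) := by
        gcongr
        exact (Finset.abs_sum_le_sum_abs _ _).trans (Finset.sum_le_sum fun i _ => h _)
    _ = K * ((∑ i, |(|x i| - √2)|) / (M : ℕ)) := by rw [← Finset.mul_sum, mul_div_assoc]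
    _ ≤ _ := by gcongr; exact mean_dev_le_sqrt M x

theorem exists_dBL_twoPoint_le (M : ℕ+) (x : Fin M → ℝ) :
    ∃ p, dBL (L M x) (twoPoint p) ≤ √((∑ i, sqDev (x i)) / (M : ℕ)) := by
  classical
  have hM : (0 : ℝ) < (M : ℕ) := by exact_mod_cast M.pos
  set m := (Finset.univ.filter fun i => 0 ≤ x i).card with hm
  have hmM : (m : ℝ) ≤ (M : ℕ) := by
    exact_mod_cast (Finset.card_le_univ _).trans_eq (Fintype.card_fin M)
  -- The mass at `√2` is the proportion of nonnegative particles; it must not depend on the test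
  -- function `f`.
  refine ⟨⟨m / (M : ℕ), by positivity, (div_le_one hM).2 hmM⟩, ?_⟩
  have : Nonempty FLU := ⟨⟨fun _ => 0, LipschitzWith.const' 0, by simp⟩⟩
  refine ciSup_le fun ⟨f, hf, _⟩ => ?_
  change |∫ y, f y ∂(empiricalMeasure M x) - _| ≤ _
  rw [integral_empiricalMeasure, integral_twoPoint]
  have hsum : (m / (M : ℕ) * f √2 + (1 - m / (M : ℕ)) * f (-√2) : ℝ) =
      (∑ i, if 0 ≤ x i then f √2 else f (-√2)) / (M : ℕ) := by
    have hcard := Finset.card_filter_add_card_filter_not (s := (Finset.univ : Finset (Fin M)))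
      (fun i => 0 ≤ x i)
    rw [← hm, Finset.card_univ, Fintype.card_fin] at hcard
    have hcard' : ((Finset.univ.filter fun i => ¬ 0 ≤ x i).card : ℝ) = (M : ℕ) - m := by
      exact eq_sub_of_add_eq' (by exact_mod_cast hcard)
    rw [Finset.sum_ite, Finset.sum_const, Finset.sum_const, nsmul_eq_mul, nsmul_eq_mul, hcard', ← hm]
    field_simp
  simp only [hsum]
  rw [← one_mul (√(_ / _))]
  refine abs_mean_sub_mean_le M x (g := fun y => if 0 ≤ y then f √2 else f (-√2)) zero_le_one
    fun y => ?_
  have hl (a b : ℝ) : |f a - f b| ≤ |a - b| := by simpa [Real.dist_eq] using hf.dist_le_mul a b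
  split_ifs with hy
  · simpa [abs_of_nonneg hy] using hl y √2
  · refine (hl y (-√2)).trans_eq ?_
    rw [abs_of_neg (not_le.1 hy), one_mul, ← abs_neg]
    ring_nf

theorem dBL_nonneg (μ ν : ProbabilityMeasure ℝ) : 0 ≤ dBL μ ν :=
  Real.iSup_nonneg fun _ => abs_nonneg _

theorem dBLSet_M0_le (M : ℕ+) (x : Fin M → ℝ) :
    dBLSet (L M x) M0 ≤ √((∑ i, sqDev (x i)) / (M : ℕ)) := by
  obtain ⟨p, hp⟩ := exists_dBL_twoPoint_le M x
  exact (ciInf_le ⟨0, by rintro _ ⟨ν, rfl⟩; exact dBL_nonneg _ _⟩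
    (⟨twoPoint p, p, rfl⟩ : M0)).trans hp

theorem dBLSet_nonneg (μ : ProbabilityMeasure ℝ) (S : Set (ProbabilityMeasure ℝ)) :
    0 ≤ dBLSet μ S :=
  Real.iInf_nonneg fun _ => dBL_nonneg _ _

/-! ### Reflection symmetry and the mean measure. -/

/-- `Q M N` is invariant under `x ↦ -x`. -/
theorem measurePreserving_neg_Q (M N : ℕ) : MeasurePreserving Neg.neg (Q M N) (Q M N) := by
  refine ⟨measurable_neg, ?_⟩
  ext s hs
  rw [Measure.map_apply measurable_neg hs]
  simp only [Q, Measure.smul_apply]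
  rw [withDensity_apply _ hs, withDensity_apply _ (measurable_neg hs),
    ← (Measure.measurePreserving_neg (volume : Measure (Fin M → ℝ))).setLIntegral_comp_preimage hs
      (measurable_density M N).ennreal_ofReal]
  simp only [density_neg]

theorem meanL_eq_smul_sum_map {Ω : Type*} [MeasurableSpace Ω] (P : Measure Ω)
    [IsProbabilityMeasure P] (M : ℕ+) (X : Ω → Fin M → ℝ) (hX : AEMeasurable X P) :
    (meanL P M X hX : Measure ℝ) = ((M : ℕ) : ENNReal)⁻¹ • ∑ i, P.map fun ω => X ω i := by
  change (P.bind fun ω => empiricalMeasure M (X ω)) = _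
  ext s hs
  have hXi (i : Fin M) : AEMeasurable (fun ω => X ω i) P := (measurable_pi_apply i).comp_aemeasurable hX
  have hL : AEMeasurable (fun ω => empiricalMeasure M (X ω)) P :=
    (measurable_empiricalMeasure M).comp_aemeasurable hX
  rw [Measure.bind_apply hs hL]
  simp only [empiricalMeasure, Measure.smul_apply, Measure.finsetSum_apply, smul_eq_mul]
  have hd (i : Fin M) : AEMeasurable (fun ω => Measure.dirac (X ω i) s) P :=
    ((Measure.measurable_coe hs).comp Measure.measurable_dirac).comp_aemeasurable (hXi i)
  rw [lintegral_const_mul'' _ (Finset.aemeasurable_fun_sum _ fun i _ => hd i),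
    lintegral_finsetSum' _ fun i _ => hd i]
  congr 2 with i
  rw [Measure.map_apply_of_aemeasurable (hXi i) hs, ← lintegral_indicator_one₀ ((hXi i).nullMeasurable hs)]
  simp only [Measure.dirac_apply' _ hs]
  rfl

theorem integral_meanL {Ω : Type*} [MeasurableSpace Ω] (P : Measure Ω)
    [IsProbabilityMeasure P] (M : ℕ+) (X : Ω → Fin M → ℝ) (hX : AEMeasurable X P)
    {f : ℝ → ℝ} (hf : Continuous f) {B : ℝ} (hB : ∀ y, |f y| ≤ B) :
    ∫ y, f y ∂(meanL P M X hX : Measure ℝ) = ∫ ω, (∑ i, f (X ω i)) / (M : ℕ) ∂P := by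
  have hXi (i : Fin M) : AEMeasurable (fun ω => X ω i) P := (measurable_pi_apply i).comp_aemeasurable hX
  have hint (i : Fin M) : Integrable (fun ω => f (X ω i)) P :=
    .of_bound (hf.measurable.comp_aemeasurable (hXi i)).aestronglyMeasurable B (.of_forall fun ω => hB _)
  rw [meanL_eq_smul_sum_map, integral_smul_measure, integral_finsetSum_measure, integral_div,
    integral_finsetSum _ fun i _ => hint i]
  · simp only [integral_map (hXi _) hf.aestronglyMeasurable]
    simp [div_eq_inv_mul]
  · intro i _
    rw [integrable_map_measure hf.aestronglyMeasurable (hXi i)]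
    exact hint i

/-- Test functions may be symmetrized under the mean empirical measure. -/
theorem integral_mean_eq_symm {Ω : Type*} [MeasurableSpace Ω] {P : Measure Ω}
    [IsProbabilityMeasure P] {M N : ℕ} {X : Ω → Fin M → ℝ} (hX : HasLaw X (Q M N) P)
    {f : ℝ → ℝ} (hf : Continuous f) {B : ℝ} (hB : ∀ y, |f y| ≤ B) :
    ∫ ω, (∑ i, f (X ω i)) / M ∂P = ∫ ω, (∑ i, (f (X ω i) + f (-(X ω i))) / 2) / M ∂P := by
  have hF : Continuous fun x : Fin M → ℝ => (∑ i, f (x i)) / M := by fun_prop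
  have hneg : HasLaw (fun ω => -X ω) (Q M N) P := (measurePreserving_neg_Q M N).fun_comp_hasLaw hX
  have h1 := hX.integral_comp hF.aestronglyMeasurable
  have h2 := hneg.integral_comp hF.aestronglyMeasurable
  simp only [Function.comp_def, Pi.neg_apply] at h1 h2
  have hint {Y : Ω → Fin M → ℝ} (hY : AEMeasurable Y P) :
      Integrable (fun ω => (∑ i, f (Y ω i)) / M) P := by
    refine .of_bound (hF.measurable.comp_aemeasurable hY).aestronglyMeasurable (M * B / M)
      (.of_forall fun ω => ?_)
    rw [Real.norm_eq_abs, abs_div, Nat.abs_cast]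
    gcongr
    refine (Finset.abs_sum_le_sum_abs _ _).trans ((Finset.sum_le_sum fun i _ => hB _).trans_eq ?_)
    simp
  have hi1 := hint hX.aemeasurable
  have hi2 := hint hneg.aemeasurable
  simp only [Pi.neg_apply] at hi2
  have : ∀ ω, (∑ i, (f (X ω i) + f (-(X ω i))) / 2) / M =
      ((∑ i, f (X ω i)) / M + (∑ i, f (-(X ω i))) / M) / 2 := fun ω => by
    rw [← Finset.sum_div, Finset.sum_add_distrib]; ring
  simp only [this]
  rw [integral_div 2, integral_add hi1 hi2, h1, h2]
  ring

end ConditionedGUE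

/-! ### Conclusion. -/

theorem corollary3p1 {Ω : Type*} [MeasurableSpace Ω] (P : Measure Ω) [IsProbabilityMeasure P]
    (N : ℕ+ → ℕ) (hMN : ∀ M : ℕ+, (M : ℕ) ≤ N M)
    (hN : Tendsto (fun M : ℕ+ => ((M : ℕ) : ℝ) / (N M : ℝ)) atTop (𝓝 0))
    (X : (M : ℕ+) → Ω → Fin M → ℝ)
    (hX : ∀ M : ℕ+, HasLaw (X M) (ConditionedGUE.Q M (N M)) P) :
    (∀ᵐ ω ∂P, Tendsto
      (fun M : ℕ+ => ConditionedGUE.dBLSet (ConditionedGUE.L M (X M ω)) ConditionedGUE.M0)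
      atTop (𝓝 0)) ∧
    Tendsto (fun M : ℕ+ => ConditionedGUE.meanL P M (X M) (hX M).aemeasurable) atTop
      (𝓝 (ConditionedGUE.twoPoint ⟨1 / 2, by norm_num, by norm_num⟩)) := by
  have hsq : ∀ᵐ ω ∂P, Tendsto
      (fun M : ℕ+ => √((∑ i, ConditionedGUE.sqDev (X M ω i)) / (M : ℕ))) atTop (𝓝 0) := by
    filter_upwards [ConditionedGUE.ae_tendsto_mean_sqDev hMN hN hX] with ω hω
    simpa using hω.sqrt
  refine ⟨?_, ?_⟩
  · filter_upwards [hsq] with ω hω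
    exact squeeze_zero (fun M => ConditionedGUE.dBLSet_nonneg _ _)
      (fun M => ConditionedGUE.dBLSet_M0_le M _) hω
  refine tendsto_iff_forall_lipschitz_integral_tendsto.2 ?_
  rintro f ⟨C, hC⟩ ⟨K, hK⟩
  have hf := hK.continuous
  obtain ⟨B, hB⟩ : ∃ B, ∀ y, |f y| ≤ B := by
    -- `C` bounds the oscillation of `f`, not its absolute value.
    refine ⟨|f 0| + C, fun y => ?_⟩
    have h1 := hC y 0
    rw [Real.dist_eq] at h1
    linarith [abs_sub_abs_le_abs_sub (f y) (f 0)]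
  have hlip (a b : ℝ) : |f a - f b| ≤ K * |a - b| := by
    simpa [Real.dist_eq] using hK.dist_le_mul a b
  rw [ConditionedGUE.integral_twoPoint]
  set c := (f √2 + f (-√2)) / 2 with hc
  have hval : (1 / 2 * f √2 + (1 - 1 / 2) * f (-√2) : ℝ) = c := by rw [hc]; ring
  -- The even part of `f` depends only on `|y|` and equals `c` at `√2`, so the sign of a particle no
  -- longer matters.
  have hsym (y : ℝ) : |(f y + f (-y)) / 2 - c| ≤ K * |(|y| - √2)| := by
    have h1 : f y + f (-y) = f |y| + f (-|y|) := by
      rcases abs_choice y with h | h <;> rw [h]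
      rw [neg_neg, add_comm]
    have h2 := hlip |y| √2
    have h3 := hlip (-|y|) (-√2)
    rw [show -|y| - -√2 = -(|y| - √2) by ring, abs_neg] at h3
    rw [h1, hc, abs_le]
    rw [abs_le] at h2 h3
    constructor <;> linarith [h2.1, h2.2, h3.1, h3.2]
  have hsymB (y : ℝ) : |(f y + f (-y)) / 2| ≤ B := by
    have h1 := abs_le.1 (hB y)
    have h2 := abs_le.1 (hB (-y))
    exact abs_le.2 ⟨by linarith [h1.1, h2.1], by linarith [h1.2, h2.2]⟩
  simp only [hval, ConditionedGUE.integral_meanL P _ _ _ hf hB,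
    ConditionedGUE.integral_mean_eq_symm (hX _) hf hB]
  rw [← show ∫ _ : Ω, c ∂P = c by simp]
  -- The symmetrized empirical means are bounded by `B` and converge almost surely to the constant
  -- `c`.
  refine tendsto_integral_filter_of_dominated_convergence (fun _ => B) (.of_forall fun M => ?_)
    (.of_forall fun M => .of_forall fun ω => ?_) (integrable_const B) ?_
  · have : Continuous fun x : Fin M → ℝ => (∑ i, (f (x i) + f (-(x i))) / 2) / (M : ℕ) := by
      fun_prop
    exact (this.measurable.comp_aemeasurable (hX M).aemeasurable).aestronglyMeasurable
  · have hM : (0 : ℝ) < (M : ℕ) := by exact_mod_cast M.pos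
    rw [Real.norm_eq_abs, abs_div, Nat.abs_cast, div_le_iff₀ hM]
    refine (Finset.abs_sum_le_sum_abs _ _).trans
      ((Finset.sum_le_sum fun i _ => hsymB _).trans_eq ?_)
    simp [mul_comm]
  · filter_upwards [hsq] with ω hω
    rw [tendsto_iff_dist_tendsto_zero]
    have hlim := hω.const_mul (K : ℝ)
    rw [mul_zero] at hlim
    refine squeeze_zero (fun M => dist_nonneg) (fun M => ?_) hlim
    have hM : ((M : ℕ) : ℝ) ≠ 0 := by exact_mod_cast M.ne_zero
    have h := ConditionedGUE.abs_mean_sub_mean_le M (X M ω) (f := fun y => (f y + f (-y)) / 2)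
      (g := fun _ => c) K.2 hsym
    rwa [Finset.sum_const, Finset.card_univ, Fintype.card_fin, nsmul_eq_mul,
      mul_div_cancel_left₀ _ hM, ← Real.dist_eq] at h
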